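/- Let $G$ be a topological group with identity $e$, equipped with its Borel $\sigma$-algebra (with measurable multiplication $G\times G\to G$), let $(M,d)$ be a complete metric space, and let $\Phi:G\times M\to M$ be a continuous left action of $G$ on $M$ by isometries of $d$. Let $Z=(Z(t),t\ge 0)$ be a Lévy process in $G$: $Z$ has stationary and independent left increments $Z(s)^{-1}Z(t)$, $s\le t$; $Z(0)=e$ a.s.; and $\lim_{s\downarrow t}P(Z(s)^{-1}Z(t)\in A)=0$ for all $t\ge 0$ and all Borel $A\subseteq G$ with $e\notin\overline{A}$. Let $\mu_s$ be the law of $Z(s)$. For $m\in M$ put $Z^{\Phi,m}(t)=\Phi(Z(t),m)$ and, for Borel $A\subseteq M$, $$V^{\Phi,m}(A)=\int_0^\infty \mu_s\big(\{\sigma\in G:\Phi(\sigma,m)\in A\}\big)\,ds .$$ The process is called transient at $m$ if $\lim_{t\to\infty}d(Z^{\Phi,m}(t),m)=\infty$ almost surely. Fix $m\in M$. 1. If the process is transient at $m$, then $V^{\Phi,m}(K)<\infty$ for every compact set $K\subseteq M$. 2. Suppose in addition that the action is transitive, that closed bounded subsets of $(M,d)$ are compact, and that almost every path of $Z$ is right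 continuous with left limits in $G$. If $V^{\Phi,m}(K)<\infty$ for every compact set $K\subseteq M$, then the process is transient at $m$. -/

import Mathlib

open MeasureTheory ProbabilityTheory Filter Topology
open scoped NNReal ENNReal

namespace GroupLevy

variable {Ω G M : Type*} [MeasurableSpace Ω]

/-- A family `Z` of `G`-valued maps on `(Ω, P)`, indexed by `t ≥ 0`, is a *Lévy process* in the
topological group `G` (with its Borel sigma-algebra): every `Z t` is a random variable, the left
increments `Z(s)⁻¹ Z(t)`, `s ≤ t`, are stationary and independent, `Z(0) = e` almost surely, and
`Z` is stochastically continuous. -/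
structure IsLevyProcess [Group G] [TopologicalSpace G] [MeasurableSpace G]
    (P : Measure Ω) (Z : ℝ≥0 → Ω → G) : Prop where
  measurable : ∀ t, Measurable (Z t)
  /-- The law of the increment over `[s, s + h]` depends only on `h`. -/
  stationary : ∀ s t h : ℝ≥0,
    IdentDistrib (fun ω ↦ (Z s ω)⁻¹ * Z (s + h) ω) (fun ω ↦ (Z t ω)⁻¹ * Z (t + h) ω) P P
  /-- The increments over consecutive intervals `[t 0, t 1], …, [t (n-1), t n]` are jointly
  independent. -/
  indep : ∀ (n : ℕ) (t : Fin (n + 1) → ℝ≥0), Monotone t →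
    iIndepFun (fun (i : Fin n) ω ↦ (Z (t i.castSucc) ω)⁻¹ * Z (t i.succ) ω) P
  zero : ∀ᵐ ω ∂P, Z 0 ω = 1
  stochCont : ∀ (t : ℝ≥0) (A : Set G), MeasurableSet A → (1 : G) ∉ closure A →
    Tendsto (fun s ↦ P {ω | (Z s ω)⁻¹ * Z t ω ∈ A}) (𝓝[>] t) (𝓝 0)

/-- Almost every path of `Z` is right continuous with left limits. -/
def IsCadlag [TopologicalSpace G] (P : Measure Ω) (Z : ℝ≥0 → Ω → G) : Prop :=
  ∀ᵐ ω ∂P, ∀ t : ℝ≥0, ContinuousWithinAt (fun s ↦ Z s ω) (Set.Ici t) t ∧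
    (0 < t → ∃ l : G, Tendsto (fun s ↦ Z s ω) (𝓝[<] t) (𝓝 l))

/-- The process `Z^{Φ,m}(t) = Φ(Z(t), m)` induced on `M` by the action `Φ(σ, p) = σ • p`. -/
def inducedProcess [SMul G M] (Z : ℝ≥0 → Ω → G) (m : M) : ℝ≥0 → Ω → M :=
  fun t ω ↦ Z t ω • m

/-- `Z` is *transient at `m`*: `d(Z^{Φ,m}(t), m) → ∞` as `t → ∞`, almost surely. -/
def IsTransientAt [SMul G M] [PseudoMetricSpace M] (P : Measure Ω) (Z : ℝ≥0 → Ω → G)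
    (m : M) : Prop :=
  ∀ᵐ ω ∂P, Tendsto (fun t : ℝ≥0 ↦ dist (inducedProcess Z m t ω) m) atTop atTop

/-- The potential measure `V(A) = ∫₀^∞ μ_s(A) ds` of `Z`, where `μ_s` is the law of `Z(s)`. -/
noncomputable def potential [MeasurableSpace G] (P : Measure Ω) (Z : ℝ≥0 → Ω → G)
    (A : Set G) : ℝ≥0∞ :=
  ∫⁻ s in Set.Ioi (0 : ℝ), (P.map (Z s.toNNReal)) A

/-- The induced potential measure `V^{Φ,m} = V ∘ Φ_m⁻¹`, where `Φ_m(σ) = σ • m`. -/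
noncomputable def inducedPotential [SMul G M] [MeasurableSpace G] (P : Measure Ω)
    (Z : ℝ≥0 → Ω → G) (m : M) (A : Set M) : ℝ≥0∞ :=
  potential P Z ((fun σ : G ↦ σ • m) ⁻¹' A)

end GroupLevy

/-! Write D(g) = d(g m, m). Because the action is isometric, D is symmetric under inversion and
subadditive, so both parts become statements about D of the left increments.

Part 1 counts visits. Transience gives N such that, with probability p > 0, D exceeds 2r at every
integer time from N on (`exists_escape_pos`). "In the r-ball at time u + n, and moved by more than
2r after every further k ≥ N steps" has probability p times that of the visit, and each path
satisfies this for at most N values of n. Hence the expected number of visits at u, u + 1, … is at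
most N / p for every u (`sum_visits_mul_escape_le`); integrating over u in (0, 1] bounds the
potential.

Part 2 is Borel–Cantelli. Stochastic continuity gives h such that increments over times up to h have
D ≤ 1 with probability at least 1/2. Finite potential then makes the visit probabilities at the
times nh summable (`tsum_visits_ne_top`), and an Ottaviani inequality extends this to visits at any
dyadic time of [nh, nh + h] (`measure_exists_dyadic_visit_le`). Right continuity covers the
remaining times. -/

namespace GroupLevy

/-- The left increment `Z(s)⁻¹ Z(t)`. -/
def increment {Ω G : Type*} [Group G] (Z : ℝ≥0 → Ω → G) (s t : ℝ≥0) (ω : Ω) : G :=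
  (Z s ω)⁻¹ * Z t ω

/-- The distance by which `g` moves the point `m`. -/
def displacement {G M : Type*} [SMul G M] [PseudoMetricSpace M] (m : M) (g : G) : ℝ :=
  dist (g • m) m

/-! ### Displacement as a length function on the group -/

section Displacement

variable {G M : Type*} [Group G] [MetricSpace M] [MulAction G M]

@[simp]
lemma displacement_one (m : M) : displacement m (1 : G) = 0 := by
  simp [displacement]

section Continuity

variable [TopologicalSpace G] [ContinuousSMul G M]

lemma continuous_displacement (m : M) : Continuous (displacement m : G → ℝ) := by
  unfold displacement
  fun_prop

lemma measurable_displacement [MeasurableSpace G] [BorelSpace G] (m : M) :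
    Measurable (displacement m : G → ℝ) :=
  (continuous_displacement m).measurable

end Continuity

variable [IsIsometricSMul G M]

lemma displacement_inv (m : M) (g : G) : displacement m g⁻¹ = displacement m g := by
  rw [displacement, displacement, ← dist_smul g (g⁻¹ • m) m, smul_inv_smul, dist_comm]

lemma displacement_mul_le (m : M) (g h : G) :
    displacement m (g * h) ≤ displacement m g + displacement m h := by
  have h₁ : dist ((g * h) • m) (g • m) = displacement m h := by
    rw [mul_smul, dist_smul, displacement]
  have h₂ := dist_triangle ((g * h) • m) (g • m) m
  simp only [displacement] at *
  linarith

lemma displacement_le_mul_add (m : M) (g h : G) :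
    displacement m h ≤ displacement m (g * h) + displacement m g := by
  have := displacement_mul_le m g⁻¹ (g * h)
  rw [inv_mul_cancel_left, displacement_inv] at this
  linarith

end Displacement

/-! ### Independence and stationarity along sequences of times -/

section Increment

variable {Ω G : Type*} [Group G] {Z : ℝ≥0 → Ω → G}

@[simp]
lemma increment_self (s : ℝ≥0) (ω : Ω) : increment Z s s ω = 1 := by
  simp [increment]

lemma increment_mul_increment (r s t : ℝ≥0) (ω : Ω) :
    increment Z r s ω * increment Z s t ω = increment Z r t ω := by
  simp [increment, mul_assoc]

namespace IsLevyProcess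

variable [MeasurableSpace Ω] {P : Measure Ω} [TopologicalSpace G] [MeasurableSpace G]

/-- `Z 0` is the identity only almost surely; working with increments from time 0 makes the product
identities hold at every ω, at the cost of one null set. -/
lemma increment_zero_ae (hZ : IsLevyProcess P Z) : ∀ᵐ ω ∂P, ∀ t, increment Z 0 t ω = Z t ω := by
  filter_upwards [hZ.zero] with ω h t
  simp [increment, h]

lemma identDistrib_increment (hZ : IsLevyProcess P Z) (s t h : ℝ≥0) :
    IdentDistrib (increment Z s (s + h)) (increment Z t (t + h)) P P :=
  hZ.stationary s t h

/-- The increments along a monotone sequence of times are jointly independent. -/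
lemma iIndepFun_increment (hZ : IsLevyProcess P Z) {τ : ℕ → ℝ≥0} (hτ : Monotone τ) :
    iIndepFun (fun i ↦ increment Z (τ i) (τ (i + 1))) P := by
  rw [iIndepFun_iff_finset]
  intro s
  obtain ⟨n, hn⟩ : ∃ n, ∀ i ∈ s, i < n := ⟨s.sup id + 1, fun i hi ↦
    Nat.lt_succ_of_le (Finset.le_sup (f := id) hi)⟩
  have h := hZ.indep n (fun i ↦ τ i) (fun i j hij ↦ hτ hij)
  exact h.precomp (g := fun i : s ↦ (⟨i, hn i i.2⟩ : Fin n))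
    (fun i j hij ↦ Subtype.ext (congrArg Fin.val hij))

/-- The law of the process of increments along an arithmetic progression does not depend on its
starting point. -/
lemma identDistrib_increment_progression [MeasurableMul₂ G] (hZ : IsLevyProcess P Z) (s t h : ℝ≥0) :
    IdentDistrib (fun ω (k : ℕ) ↦ increment Z s (s + k * h) ω)
      (fun ω (k : ℕ) ↦ increment Z t (t + k * h) ω) P P := by
  have hmono : ∀ s : ℝ≥0, Monotone fun i : ℕ ↦ s + i * h := fun s i j hij ↦ by
    dsimp only
    gcongr
  have hpi := IdentDistrib.pi (μ := P) (ν := P)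
    (X := fun i : ℕ ↦ increment Z (s + i * h) (s + (i + 1 : ℕ) * h))
    (Y := fun i : ℕ ↦ increment Z (t + i * h) (t + (i + 1 : ℕ) * h))
    (fun i ↦ by
      have := hZ.identDistrib_increment (s + i * h) (t + i * h) h
      simpa [add_mul, add_assoc] using this)
    (hZ.iIndepFun_increment (hmono s)) (hZ.iIndepFun_increment (hmono t))
  -- Partial products: they rebuild the long increments measurably from the one-step ones, whose
  -- joint law is already known.
  let F : (ℕ → G) → ℕ → G := fun y k ↦ Nat.rec 1 (fun i g ↦ g * y i) k
  have hF : Measurable F := by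
    refine measurable_pi_lambda _ fun k ↦ ?_
    induction k with
    | zero => exact measurable_const
    | succ k ih => exact ih.mul (measurable_pi_apply k)
  have hFY : ∀ s : ℝ≥0, (fun ω (k : ℕ) ↦ increment Z s (s + k * h) ω) =
      F ∘ fun ω (i : ℕ) ↦ increment Z (s + i * h) (s + (i + 1 : ℕ) * h) ω := by
    intro s
    ext ω k
    induction k with
    | zero => simp [F]
    | succ k ih =>
      rw [← increment_mul_increment s (s + k * h), ih]
      rfl
  rw [hFY s, hFY t]
  exact hpi.comp hF

variable [IsTopologicalGroup G] [BorelSpace G] [MeasurableMul₂ G]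

lemma measurable_increment (hZ : IsLevyProcess P Z) (s t : ℝ≥0) : Measurable (increment Z s t) :=
  (hZ.measurable s).inv.mul (hZ.measurable t)

/-- The process up to the `n`-th time is independent of the increments after it. -/
lemma indepFun_past_future (hZ : IsLevyProcess P Z) {τ : ℕ → ℝ≥0} (hτ : Monotone τ) (n : ℕ) :
    IndepFun (fun ω i ↦ increment Z (τ 0) (τ (min i n)) ω)
      (fun ω k ↦ increment Z (τ n) (τ (n + k)) ω) P := by
  set Y : ℕ → Ω → G := fun i ↦ increment Z (τ i) (τ (i + 1)) with hY
  have hind := indep_iSup_of_disjoint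
    (m := fun i ↦ (inferInstance : MeasurableSpace G).comap (Y i))
    (fun i ↦ (hZ.measurable_increment _ _).comap_le)
    (hZ.iIndepFun_increment hτ) (S := Set.Iio n) (T := Set.Ici n)
    (Set.disjoint_left.2 fun i hi hj ↦ not_lt.2 (Set.mem_Ici.1 hj) hi)
  have hmeas : ∀ (S : Set ℕ) (i : ℕ), i ∈ S →
      Measurable[⨆ i ∈ S, (inferInstance : MeasurableSpace G).comap (Y i)] (Y i) := by
    intro S i hi
    exact (comap_measurable (Y i)).mono (le_iSup₂_of_le i hi le_rfl) le_rfl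
  refine indep_of_indep_of_le_left (indep_of_indep_of_le_right hind ?_) ?_
  · refine Measurable.comap_le (@measurable_pi_lambda _ _ _ (_) _ _ fun k ↦ ?_)
    induction k with
    | zero => simp
    | succ k ih =>
      have := (measurable_mul (M := G)).comp (ih.prodMk (hmeas (Set.Ici n) (n + k) (by simp)))
      convert! this using 1
      ext ω
      simp [hY, increment_mul_increment, add_assoc]
  · refine Measurable.comap_le (@measurable_pi_lambda _ _ _ (_) _ _ fun i ↦ ?_)
    induction i with
    | zero => simp
    | succ i ih =>
      rcases lt_or_ge i n with hi | hi
      · have := (measurable_mul (M := G)).comp (ih.prodMk (hmeas (Set.Iio n) i hi))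
        convert! this using 1
        ext ω
        rw [min_eq_left hi.le, min_eq_left (Nat.succ_le_of_lt hi)]
        simp [hY, increment_mul_increment]
      · rw [min_eq_right hi] at ih
        rwa [min_eq_right (hi.trans i.le_succ)]

end IsLevyProcess

end Increment

/-! ### Counting, integration and escape estimates -/

/-- If no point belongs to two of the sets `A i`, `A j` with `j - i ≥ N`, then the measures of
these sets add up to at most `N`. -/
lemma sum_measure_le_of_gap {Ω : Type*} [MeasurableSpace Ω] {P : Measure Ω}
    [IsProbabilityMeasure P] {A : ℕ → Set Ω} (hA : ∀ n, MeasurableSet (A n)) {N : ℕ}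
    (hgap : ∀ n k ω, N ≤ k → ω ∈ A n → ω ∉ A (n + k)) (L : ℕ) :
    ∑ n ∈ Finset.range L, P (A n) ≤ N := by
  classical
  have hcard : ∀ ω, ∑ n ∈ Finset.range L, (A n).indicator (1 : Ω → ℝ≥0∞) ω ≤ N := by
    intro ω
    have h₁ : ∑ n ∈ Finset.range L, (A n).indicator (1 : Ω → ℝ≥0∞) ω =
        ((Finset.range L).filter fun n ↦ ω ∈ A n).card := by
      simp [Set.indicator_apply]
    rw [h₁, Nat.cast_le]
    set S := (Finset.range L).filter fun n ↦ ω ∈ A n with hS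
    rcases S.eq_empty_or_nonempty with h | h
    · simp [h]
    · have hsub : S ⊆ Finset.Ico (S.min' h) (S.min' h + N) := by
        intro n hn
        have hle := S.min'_le n hn
        have hmin : ω ∈ A (S.min' h) := (Finset.mem_filter.1 (S.min'_mem h)).2
        refine Finset.mem_Ico.2 ⟨hle, ?_⟩
        by_contra! hlt
        have := hgap _ (n - S.min' h) ω (by omega) hmin
        rw [Nat.add_sub_cancel' hle] at this
        exact this (Finset.mem_filter.1 hn).2
      simpa using Finset.card_le_card hsub
  calc ∑ n ∈ Finset.range L, P (A n)
      = ∫⁻ ω, ∑ n ∈ Finset.range L, (A n).indicator (1 : Ω → ℝ≥0∞) ω ∂P := by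
        rw [lintegral_finsetSum _ fun n _ ↦ measurable_one.indicator (hA n)]
        simp [lintegral_indicator_one (hA _)]
    _ ≤ ∫⁻ _, N ∂P := lintegral_mono hcard
    _ = N := by simp

/-- Summing over a partition into unit intervals bounds the (lower) integral over `(0, ∞)`. -/
lemma lintegral_Ioi_le_of_sum_translates_le {f : ℝ → ℝ≥0∞} {C : ℝ≥0∞}
    (hf : ∀ u ∈ Set.Ioc (0 : ℝ) 1, ∀ L : ℕ, ∑ n ∈ Finset.range L, f (u + n) ≤ C) :
    ∫⁻ s in Set.Ioi (0 : ℝ), f s ≤ C := by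
  have hU : Set.Ioi (0 : ℝ) = ⋃ n : ℕ, Set.Ioc (n : ℝ) ((n + 1 : ℕ) : ℝ) := by
    have := iUnion_Ioc_map_succ_eq_Ioi (f := fun n : ℕ ↦ (n : ℝ)) (fun a ↦ by simp) (by
      rintro ⟨b, hb⟩
      obtain ⟨n, hn⟩ := exists_nat_gt b
      exact absurd (hb ⟨n, rfl⟩) (not_le.2 hn))
    simpa using this.symm
  have hdisj : Pairwise (Function.onFun Disjoint fun n : ℕ ↦ Set.Ioc (n : ℝ) ((n + 1 : ℕ) : ℝ)) :=
    (Nat.mono_cast (α := ℝ)).pairwise_disjoint_on_Ioc_succ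
  have htrans : ∀ n : ℕ, ∫⁻ s in Set.Ioc (n : ℝ) ((n + 1 : ℕ) : ℝ), f s =
      ∫⁻ u in Set.Ioc (0 : ℝ) 1, f (u + n) := by
    intro n
    have h := ((measurePreserving_add_right (volume : Measure ℝ) (n : ℝ)).setLIntegral_comp_preimage_emb
      (MeasurableEquiv.addRight (n : ℝ)).measurableEmbedding f
      (Set.Ioc (n : ℝ) ((n + 1 : ℕ) : ℝ)))
    rw [← h]
    simp
  rw [hU, lintegral_iUnion (fun n ↦ measurableSet_Ioc) hdisj]
  refine ENNReal.tsum_le_of_sum_range_le fun L ↦ ?_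
  simp only [htrans]
  -- `f` need not be measurable, so only superadditivity of the lower integral is available; it is
  -- the direction needed.
  have hsuper : ∀ L : ℕ, ∑ n ∈ Finset.range L, ∫⁻ u in Set.Ioc (0 : ℝ) 1, f (u + n) ≤
      ∫⁻ u in Set.Ioc (0 : ℝ) 1, ∑ n ∈ Finset.range L, f (u + n) := by
    intro L
    induction L with
    | zero => simp
    | succ L ih =>
      simp only [Finset.sum_range_succ]
      exact (add_le_add_left ih _).trans (le_lintegral_add _ _)
  refine (hsuper L).trans ((setLIntegral_mono measurable_const fun u hu ↦ hf u hu L).trans ?_)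
  simp

/-- The induced potential of a closed ball, in terms of the increments from time `0`. -/
lemma IsLevyProcess.inducedPotential_closedBall {Ω G M : Type*} [MeasurableSpace Ω]
    {P : Measure Ω} [Group G] [TopologicalSpace G] [MeasurableSpace G] [BorelSpace G]
    [MetricSpace M] [MulAction G M] [ContinuousSMul G M] {Z : ℝ≥0 → Ω → G}
    (hZ : IsLevyProcess P Z) (m : M) (r : ℝ) :
    inducedPotential P Z m (Metric.closedBall m r) =
      ∫⁻ s in Set.Ioi (0 : ℝ), P {ω | displacement m (increment Z 0 s.toNNReal ω) ≤ r} := by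
  rw [inducedPotential, potential]
  congr with s
  rw [Measure.map_apply (hZ.measurable _)]
  · refine measure_congr ?_
    filter_upwards [hZ.increment_zero_ae] with ω hω
    refine propext ?_
    change _ ↔ displacement m (increment Z 0 s.toNNReal ω) ≤ r
    rw [hω]
    rfl
  · exact measurableSet_le (measurable_displacement (G := G) m) measurable_const

/-- For a transient process, the probability of not returning to a ball after a sufficiently late
time is positive. -/
lemma IsTransientAt.exists_escape_pos {Ω G M : Type*} [MeasurableSpace Ω] {P : Measure Ω}
    [IsProbabilityMeasure P] [Group G] [TopologicalSpace G] [MeasurableSpace G]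
    [MetricSpace M] [MulAction G M] {Z : ℝ≥0 → Ω → G} (hZ : IsLevyProcess P Z) {m : M} (h : IsTransientAt P Z m)
    (R : ℝ) :
    ∃ N : ℕ, P {ω | ∀ k : ℕ, N ≤ k → R < displacement m (increment Z 0 k ω)} ≠ 0 := by
  by_contra! hN
  have hnull := measure_iUnion_null hN
  have hall : ∀ᵐ ω ∂P, ω ∈ ⋃ N : ℕ, {ω | ∀ k : ℕ, N ≤ k →
      R < displacement m (increment Z 0 k ω)} := by
    filter_upwards [h, hZ.increment_zero_ae] with ω hω hω₀
    have := (hω.comp (tendsto_natCast_atTop_atTop (R := ℝ≥0))).eventually_gt_atTop R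
    obtain ⟨N, hN⟩ := eventually_atTop.1 this
    refine Set.mem_iUnion.2 ⟨N, fun k hk ↦ ?_⟩
    rw [hω₀]
    exact hN k hk
  have hfalse : ∀ᵐ _ω ∂P, False := by
    filter_upwards [hall, measure_eq_zero_iff_ae_notMem.1 hnull] with ω h₁ h₂ using h₂ h₁
  simp only [ae_iff, not_false_eq_true] at hfalse
  simp at hfalse

/-! ### Transience implies finite potential -/

section Transient

variable {Ω G M : Type*} [MeasurableSpace Ω] {P : Measure Ω} [IsProbabilityMeasure P]
  [Group G] [TopologicalSpace G] [IsTopologicalGroup G]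
  [MeasurableSpace G] [BorelSpace G] [MeasurableMul₂ G]
  [MetricSpace M] [MulAction G M] [ContinuousSMul G M] [IsIsometricSMul G M]
  {Z : ℝ≥0 → Ω → G}

/-- A bound for the expected number of visits to a ball at the times `u, u + 1, …`, in terms of
the probability of not returning to a larger ball after `N` steps. -/
lemma IsLevyProcess.sum_visits_mul_escape_le (hZ : IsLevyProcess P Z) (m : M) (r : ℝ) (N : ℕ)
    (u : ℝ≥0) (L : ℕ) :
    (∑ n ∈ Finset.range L, P {ω | displacement m (increment Z 0 (u + n) ω) ≤ r}) *
      P {ω | ∀ k : ℕ, N ≤ k → 2 * r < displacement m (increment Z 0 k ω)} ≤ N := by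
  have hD := measurable_displacement (G := G) m
  let E : Set (ℕ → G) := {y | ∀ k, N ≤ k → 2 * r < displacement m (y k)}
  have hE : MeasurableSet E := by
    have : E = ⋂ k, ⋂ _ : N ≤ k, {y | 2 * r < displacement m (y k)} := by ext; simp [E]
    rw [this]
    exact .iInter fun k ↦ .iInter fun _ ↦
      measurableSet_lt measurable_const (hD.comp (measurable_pi_apply k))
  let B : Set (ℕ → G) := {y | displacement m (y 1) ≤ r}
  have hB : MeasurableSet B :=
    measurableSet_le (hD.comp (measurable_pi_apply 1)) measurable_const
  let A : ℕ → Set Ω := fun n ↦ {ω | displacement m (increment Z 0 (u + n) ω) ≤ r ∧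
    ∀ k : ℕ, N ≤ k → 2 * r < displacement m (increment Z (u + n) (u + n + k) ω)}
  have hprod : ∀ n, MeasurableSet (A n) ∧
      P (A n) = P {ω | displacement m (increment Z 0 (u + n) ω) ≤ r} *
        P {ω | ∀ k : ℕ, N ≤ k → 2 * r < displacement m (increment Z 0 k ω)} := by
    intro n
    -- Time 0 is prepended to the progression u + n, u + n + 1, …, so that index 1 separates past
    -- from future.
    let τ : ℕ → ℝ≥0 := fun i ↦ if i = 0 then 0 else u + n + (i - 1 : ℕ)
    have hτ : Monotone τ := by
      refine monotone_nat_of_le_succ fun i ↦ ?_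
      rcases i with _ | i
      · simp [τ]
      · simp [τ]
    have h₁ := (hZ.indepFun_past_future hτ 1).measure_inter_preimage_eq_mul B E hB hE
    have h₂ := (hZ.identDistrib_increment_progression (u + n) 0 1).measure_mem_eq hE
    have hτ' : ∀ k, τ (1 + k) = u + n + k := fun k ↦ by simp [τ]
    have hτ₁ : τ 1 = u + n := by simp [τ]
    have hτ₀ : τ 0 = 0 := by simp [τ]
    simp only [hτ', hτ₁, hτ₀] at h₁
    simp only [mul_one, zero_add] at h₂
    rw [h₂] at h₁
    simp only [B, Set.preimage_ofPred_eq, min_self, hτ₁, E] at h₁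
    refine ⟨?_, h₁⟩
    have hmeas : Measurable fun ω (k : ℕ) ↦ increment Z (u + n) (u + n + k) ω :=
      measurable_pi_lambda _ fun k ↦ hZ.measurable_increment _ _
    exact (measurableSet_le (hD.comp (hZ.measurable_increment _ _)) measurable_const).inter
      (hmeas hE)
  rw [Finset.sum_mul, ← Finset.sum_congr rfl fun n _ ↦ (hprod n).2]
  refine sum_measure_le_of_gap (fun n ↦ (hprod n).1) (fun n k ω hk h h' ↦ ?_) L
  -- Two positions within r of m are joined by an increment of displacement at most 2r,
  -- contradicting escape.
  have h₁ := h.2 k hk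
  have h₂ := displacement_le_mul_add m (increment Z 0 (u + n) ω)
    (increment Z (u + n) (u + n + k) ω)
  rw [increment_mul_increment] at h₂
  have h₃ := h'.1
  rw [Nat.cast_add, ← add_assoc] at h₃
  linarith [h.1]

theorem IsTransientAt.inducedPotential_lt_top (hZ : IsLevyProcess P Z) {m : M}
    (h : IsTransientAt P Z m) {K : Set M} (hK : Bornology.IsBounded K) :
    inducedPotential P Z m K < ∞ := by
  obtain ⟨r, hr⟩ := hK.subset_closedBall m
  obtain ⟨N, hN⟩ := h.exists_escape_pos hZ (2 * r)
  have hmono : inducedPotential P Z m K ≤ inducedPotential P Z m (Metric.closedBall m r) :=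
    lintegral_mono fun s ↦ measure_mono (Set.preimage_mono hr)
  refine hmono.trans_lt ?_
  rw [hZ.inducedPotential_closedBall]
  refine (lintegral_Ioi_le_of_sum_translates_le (C := N / P {ω | ∀ k : ℕ, N ≤ k →
    2 * r < displacement m (increment Z 0 k ω)}) fun u hu L ↦ ?_).trans_lt
    (ENNReal.div_lt_top (by simp) hN)
  rw [ENNReal.le_div_iff_mul_le (Or.inl hN) (Or.inl (measure_ne_top _ _))]
  convert hZ.sum_visits_mul_escape_le m r N u.toNNReal L using 7 with n
  rw [Real.toNNReal_add hu.1.le (by positivity), Real.toNNReal_natCast]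

end Transient

/-! ### Finite potential implies transience -/

section Recurrence

variable {Ω G M : Type*} [MeasurableSpace Ω] {P : Measure Ω}
  [Group G] [TopologicalSpace G] [IsTopologicalGroup G]
  [MeasurableSpace G] [BorelSpace G] [MeasurableMul₂ G]
  [MetricSpace M] [MulAction G M] [ContinuousSMul G M] [IsIsometricSMul G M]
  {Z : ℝ≥0 → Ω → G}

/-- Over sufficiently short time intervals, the process moves the point `m` by at most `1` with
probability at least `1 / 2`. -/
lemma IsLevyProcess.exists_half_le_small_increment [IsProbabilityMeasure P]
    (hZ : IsLevyProcess P Z) (m : M) :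
    ∃ h : ℝ≥0, 0 < h ∧ ∀ s t, s ≤ t → t ≤ s + h →
      2⁻¹ ≤ P {ω | displacement m (increment Z s t ω) ≤ 1} := by
  have hD := measurable_displacement (G := G) m
  have hclosed : IsClosed {g : G | 1 ≤ displacement m g} :=
    isClosed_le continuous_const (continuous_displacement m)
  have hlim := hZ.stochCont 0 _ hclosed.measurableSet (by simp)
  have hev := hlim.eventually (gt_mem_nhds (show (0 : ℝ≥0∞) < 2⁻¹ by simp))
  obtain ⟨h₀, hh₀, hsub⟩ := (mem_nhdsGT_iff_exists_Ioc_subset (a := (0 : ℝ≥0))).1 hev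
  refine ⟨h₀, hh₀, fun s t hst hts ↦ ?_⟩
  obtain ⟨v, rfl⟩ := exists_add_of_le hst
  have hv : v ≤ h₀ := by simpa using hts
  have hset : MeasurableSet {g : G | displacement m g ≤ 1} :=
    measurableSet_le hD measurable_const
  have hlaw := (hZ.identDistrib_increment s 0 v).measure_mem_eq hset
  simp only [Set.preimage_ofPred_eq, zero_add] at hlaw
  rw [hlaw]
  rcases eq_or_ne v 0 with rfl | hv₀
  · simp
  -- Stochastic continuity at time 0 controls `Z(v)⁻¹ Z(0)`, the inverse of the wanted increment; D
  -- does not see the difference.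
  have hlt : P {ω | 1 ≤ displacement m (increment Z v 0 ω)} < 2⁻¹ :=
    hsub ⟨pos_iff_ne_zero.2 hv₀, hv⟩
  have hmeas : MeasurableSet {ω | 1 ≤ displacement m (increment Z v 0 ω)} :=
    measurableSet_le measurable_const (hD.comp (hZ.measurable_increment _ _))
  have hcompl : {ω | 1 ≤ displacement m (increment Z v 0 ω)}ᶜ ⊆
      {ω | displacement m (increment Z 0 v ω) ≤ 1} := by
    intro ω hω
    have hinv : increment Z 0 v ω = (increment Z v 0 ω)⁻¹ := by simp [increment]
    simp only [Set.mem_compl_iff, Set.mem_ofPred_eq, not_le] at hω ⊢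
    rw [hinv, displacement_inv]
    exact hω.le
  refine le_trans ?_ (measure_mono hcompl)
  rw [prob_compl_eq_one_sub hmeas, ← ENNReal.one_sub_inv_two]
  gcongr

/-- An inequality of Ottaviani type: if the process visits a ball at one of the times `s j`, then
it is in a slightly larger ball at a shortly later time `T` with conditional probability at
least `1 / 2`. -/
lemma IsLevyProcess.measure_exists_visit_le (hZ : IsLevyProcess P Z) (m : M) (r : ℝ)
    {s : ℕ → ℝ≥0} (hs : Monotone s) {T : ℝ≥0} (hsT : ∀ j, s j ≤ T)
    (hhalf : ∀ j, 2⁻¹ ≤ P {ω | displacement m (increment Z (s j) T ω) ≤ 1}) :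
    P {ω | ∃ j, displacement m (increment Z 0 (s j) ω) ≤ r} ≤
      2 * P {ω | displacement m (increment Z 0 T ω) ≤ r + 1} := by
  have hD := measurable_displacement (G := G) m
  -- First-visit decomposition: `E j` depends on the past of s j, `F j` on the increment after it.
  let E : ℕ → Set Ω := fun j ↦ {ω | displacement m (increment Z 0 (s j) ω) ≤ r ∧
    ∀ i < j, r < displacement m (increment Z 0 (s i) ω)}
  let F : ℕ → Set Ω := fun j ↦ {ω | displacement m (increment Z (s j) T ω) ≤ 1}
  have hmeasle : ∀ a b : ℝ≥0, ∀ c : ℝ,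
      MeasurableSet {ω | displacement m (increment Z a b ω) ≤ c} := fun a b c ↦
    measurableSet_le (hD.comp (hZ.measurable_increment _ _)) measurable_const
  have hE : ∀ j, MeasurableSet (E j) := fun j ↦ by
    have : E j = {ω | displacement m (increment Z 0 (s j) ω) ≤ r} ∩
        ⋂ i, ⋂ _ : i < j, {ω | r < displacement m (increment Z 0 (s i) ω)} := by
      ext; simp [E]
    rw [this]
    exact (hmeasle _ _ _).inter (.iInter fun i ↦ .iInter fun _ ↦
      measurableSet_lt measurable_const (hD.comp (hZ.measurable_increment _ _)))
  have hEdisj : Pairwise (Function.onFun Disjoint E) := by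
    refine (Std.Symm.pairwise_on E).2 fun i j hij ↦ ?_
    exact Set.disjoint_left.2 fun ω hi hj ↦ (hj.2 i hij).not_ge hi.1
  have hUnion : {ω | ∃ j, displacement m (increment Z 0 (s j) ω) ≤ r} = ⋃ j, E j := by
    classical
    ext ω
    simp only [Set.mem_ofPred_eq, Set.mem_iUnion]
    refine ⟨fun h ↦ ⟨Nat.find h, Nat.find_spec h, fun i hi ↦ not_le.1 (Nat.find_min h hi)⟩, ?_⟩
    rintro ⟨j, hj⟩
    exact ⟨j, hj.1⟩
  have hindep : ∀ j, P (E j ∩ F j) = P (E j) * P (F j) := by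
    intro j
    -- The times 0, s 0, …, s j, T, T, …: the present s j has index j + 1.
    let τ : ℕ → ℝ≥0 := fun i ↦ if i = 0 then 0 else if i ≤ j + 1 then s (i - 1) else T
    have hτ : Monotone τ := by
      refine monotone_nat_of_le_succ fun i ↦ ?_
      rcases i with _ | i
      · simp [τ]
      · by_cases h₁ : i + 1 ≤ j
        · have h₂ : i ≤ j := by omega
          simpa [τ, h₁, h₂] using hs i.le_succ
        · by_cases h₂ : i ≤ j
          · simpa [τ, h₁, h₂] using hsT i
          · simp [τ, h₁, h₂]
    let A : Set (ℕ → G) := {y | displacement m (y (j + 1)) ≤ r ∧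
      ∀ i < j, r < displacement m (y (i + 1))}
    have hA : MeasurableSet A := by
      have : A = {y | displacement m (y (j + 1)) ≤ r} ∩
          ⋂ i, ⋂ _ : i < j, {y | r < displacement m (y (i + 1))} := by
        ext; simp [A]
      rw [this]
      exact (measurableSet_le (hD.comp (measurable_pi_apply _)) measurable_const).inter
        (.iInter fun i ↦ .iInter fun _ ↦
          measurableSet_lt measurable_const (hD.comp (measurable_pi_apply _)))
    have hB : MeasurableSet {y : ℕ → G | displacement m (y 1) ≤ 1} :=
      measurableSet_le (hD.comp (measurable_pi_apply _)) measurable_const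
    have h := (hZ.indepFun_past_future hτ (j + 1)).measure_inter_preimage_eq_mul _ _ hA hB
    have hτ₀ : τ 0 = 0 := by simp [τ]
    have hτs : ∀ i ≤ j, τ (min (i + 1) (j + 1)) = s i := fun i hi ↦ by
      rw [min_eq_left (by omega)]
      simp [τ, hi]
    have hτj : τ (j + 1) = s j := by simp [τ]
    have hτT : τ (j + 1 + 1) = T := by simp [τ]
    have hpast : (fun ω i ↦ increment Z (τ 0) (τ (min i (j + 1))) ω) ⁻¹' A = E j := by
      ext ω
      simp only [A, E, Set.mem_preimage, Set.mem_ofPred_eq, hτ₀, hτs j le_rfl]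
      refine and_congr_right fun _ ↦ forall₂_congr fun i hi ↦ ?_
      rw [hτs i hi.le]
    have hfut : (fun ω k ↦ increment Z (τ (j + 1)) (τ (j + 1 + k)) ω) ⁻¹'
        {y : ℕ → G | displacement m (y 1) ≤ 1} = F j := by
      ext ω
      simp only [F, Set.mem_preimage, Set.mem_ofPred_eq, hτj, hτT]
    rwa [hpast, hfut] at h
  have hsub : ⋃ j, (E j ∩ F j) ⊆ {ω | displacement m (increment Z 0 T ω) ≤ r + 1} := by
    refine Set.iUnion_subset fun j ω hω ↦ ?_
    have h := displacement_mul_le m (increment Z 0 (s j) ω) (increment Z (s j) T ω)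
    rw [increment_mul_increment] at h
    have h₁ : displacement m (increment Z (s j) T ω) ≤ 1 := hω.2
    exact h.trans (add_le_add hω.1.1 h₁)
  calc P {ω | ∃ j, displacement m (increment Z 0 (s j) ω) ≤ r}
      = ∑' j, P (E j) := by rw [hUnion, measure_iUnion hEdisj hE]
    _ ≤ ∑' j, 2 * P (E j ∩ F j) := by
        refine ENNReal.tsum_le_tsum fun j ↦ ?_
        calc P (E j) = 2 * (P (E j) * 2⁻¹) := by
              rw [mul_comm (P (E j)), ← mul_assoc, ENNReal.mul_inv_cancel (by simp) (by simp),
                one_mul]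
          _ ≤ 2 * P (E j ∩ F j) := by
              rw [hindep]
              gcongr
              exact hhalf j
    _ = 2 * P (⋃ j, (E j ∩ F j)) := by
        rw [ENNReal.tsum_mul_left, measure_iUnion
          (fun i j hij ↦ (hEdisj hij).mono Set.inter_subset_left Set.inter_subset_left)
          fun j ↦ (hE j).inter (hmeasle _ _ _)]
    _ ≤ _ := by gcongr

/-- The dyadic points `a + h j / 2 ^ k` of the interval `[a, a + h]`, where the index `j` is
truncated at `2 ^ k`. -/
noncomputable def dyadicTime (a h : ℝ≥0) (k j : ℕ) : ℝ≥0 :=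
  a + h * (min j (2 ^ k) : ℕ) / 2 ^ k

lemma monotone_dyadicTime (a h : ℝ≥0) (k : ℕ) : Monotone (dyadicTime a h k) := by
  intro i j hij
  unfold dyadicTime
  gcongr

lemma le_dyadicTime (a h : ℝ≥0) (k j : ℕ) : a ≤ dyadicTime a h k j :=
  le_self_add

lemma dyadicTime_le (a h : ℝ≥0) (k j : ℕ) : dyadicTime a h k j ≤ a + h := by
  unfold dyadicTime
  gcongr
  refine div_le_of_le_mul₀ (by positivity) (by positivity) ?_
  gcongr
  exact_mod_cast min_le_right j (2 ^ k)

/-- The grids are nested, so the visit events increase with k and continuity from below applies. -/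
lemma dyadicTime_succ (a h : ℝ≥0) (k j : ℕ) :
    dyadicTime a h (k + 1) (2 * j) = dyadicTime a h k j := by
  unfold dyadicTime
  have : min (2 * j) (2 ^ (k + 1)) = 2 * min j (2 ^ k) := by
    rw [pow_succ]
    omega
  rw [this, pow_succ, Nat.cast_mul, Nat.cast_two, mul_comm (2 ^ k) (2 : ℝ≥0), mul_left_comm,
    mul_div_mul_left _ _ two_ne_zero]

/-- Every point of `[a, a + h)` is a limit from the right of dyadic points. -/
lemma exists_dyadicTime_mem_Ico {a h t u : ℝ≥0} (hat : a ≤ t) (hth : t < a + h) (htu : t < u) :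
    ∃ k j, t ≤ dyadicTime a h k j ∧ dyadicTime a h k j < u := by
  obtain ⟨v, rfl⟩ := exists_add_of_le hat
  have hvh : v < h := by simpa using hth
  have hh : 0 < h := (zero_le : 0 ≤ v).trans_lt hvh
  obtain ⟨w, rfl⟩ := exists_add_of_le htu.le
  have hw : 0 < w := by simpa using htu
  obtain ⟨k, hk⟩ := exists_pow_lt_of_lt_one (div_pos hw hh) (by norm_num : (2⁻¹ : ℝ≥0) < 1)
  have h2 : (0 : ℝ≥0) < 2 ^ k := by positivity
  have hk' : h / 2 ^ k < w := by
    rw [inv_pow, lt_div_iff₀ hh] at hk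
    rwa [div_eq_mul_inv, mul_comm]
  -- First grid point not before t; the mesh h / 2 ^ k is below w, so it falls short of u.
  let j := ⌈v * 2 ^ k / h⌉₊
  have hj : j ≤ 2 ^ k := by
    refine Nat.ceil_le.2 ?_
    rw [div_le_iff₀ hh, mul_comm]
    push_cast
    gcongr
  have hval : dyadicTime a h k j = a + h * j / 2 ^ k := by
    rw [dyadicTime, min_eq_left hj]
  refine ⟨k, j, ?_, ?_⟩
  · rw [hval]
    gcongr
    rw [le_div_iff₀ h2]
    have := (div_le_iff₀ hh).1 (Nat.le_ceil (v * 2 ^ k / h))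
    rwa [mul_comm h]
  · rw [hval, add_assoc]
    gcongr
    have h₁ : (j : ℝ≥0) < v * 2 ^ k / h + 1 := Nat.ceil_lt_add_one zero_le
    calc h * j / 2 ^ k < h * (v * 2 ^ k / h + 1) / 2 ^ k := by gcongr
      _ = v + h / 2 ^ k := by field_simp
      _ < v + w := by gcongr

/-- The probability of visiting a ball at a dyadic time of a short interval `[a, a + h]` is bounded
by twice the probability of being in a slightly larger ball at the time `a + h`. -/
lemma IsLevyProcess.measure_exists_dyadic_visit_le (hZ : IsLevyProcess P Z) (m : M) (r : ℝ)
    {h : ℝ≥0} (hhalf : ∀ s t, s ≤ t → t ≤ s + h →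
      2⁻¹ ≤ P {ω | displacement m (increment Z s t ω) ≤ 1}) (a : ℝ≥0) :
    P {ω | ∃ k j, displacement m (increment Z 0 (dyadicTime a h k j) ω) ≤ r} ≤
      2 * P {ω | displacement m (increment Z 0 (a + h) ω) ≤ r + 1} := by
  have hU : {ω | ∃ k j, displacement m (increment Z 0 (dyadicTime a h k j) ω) ≤ r} =
      ⋃ k, {ω | ∃ j, displacement m (increment Z 0 (dyadicTime a h k j) ω) ≤ r} := by
    ext; simp
  have hmono : Monotone fun k ↦
      {ω | ∃ j, displacement m (increment Z 0 (dyadicTime a h k j) ω) ≤ r} := by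
    refine monotone_nat_of_le_succ fun k ω ↦ ?_
    rintro ⟨j, hj⟩
    exact ⟨2 * j, by rwa [dyadicTime_succ]⟩
  rw [hU, hmono.measure_iUnion]
  refine iSup_le fun k ↦ hZ.measure_exists_visit_le m r (monotone_dyadicTime a h k)
    (dyadicTime_le a h k) fun j ↦ hhalf _ _ (dyadicTime_le a h k j) ?_
  gcongr
  exact le_dyadicTime a h k j

/-- If balls have finite potential, then the expected number of visits to a ball along a
sufficiently fine arithmetic progression is finite. -/
lemma IsLevyProcess.tsum_visits_ne_top (hZ : IsLevyProcess P Z) (m : M) (r : ℝ) {h : ℝ≥0}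
    (hh : 0 < h) (hhalf : ∀ s t, s ≤ t → t ≤ s + h →
      2⁻¹ ≤ P {ω | displacement m (increment Z s t ω) ≤ 1})
    (hV : inducedPotential P Z m (Metric.closedBall m (r + 1)) < ∞) :
    ∑' n : ℕ, P {ω | displacement m (increment Z 0 (n * h) ω) ≤ r} ≠ ∞ := by
  rw [hZ.inducedPotential_closedBall] at hV
  have hmono : Monotone fun n : ℕ ↦ (n : ℝ) * h := fun i j hij ↦ by
    dsimp only
    gcongr
  have hdisj : Pairwise (Function.onFun Disjoint fun n : ℕ ↦
      Set.Ioc ((n : ℝ) * h) (((n + 1 : ℕ) : ℝ) * h)) := hmono.pairwise_disjoint_on_Ioc_succ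
  have hsub : (⋃ n : ℕ, Set.Ioc ((n : ℝ) * h) (((n + 1 : ℕ) : ℝ) * h)) ⊆ Set.Ioi 0 :=
    Set.iUnion_subset fun n s hs ↦ lt_of_le_of_lt (by positivity) hs.1
  have hle : ∑' n : ℕ, (P {ω | displacement m (increment Z 0 (n * h) ω) ≤ r} * (2⁻¹ * h)) ≤
      ∫⁻ s in Set.Ioi (0 : ℝ),
        P {ω | displacement m (increment Z 0 s.toNNReal ω) ≤ r + 1} := by
    refine le_trans ?_ (lintegral_mono_set hsub)
    rw [lintegral_iUnion (fun n ↦ measurableSet_Ioc) hdisj]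
    refine ENNReal.tsum_le_tsum fun n ↦ ?_
    have hvol : volume (Set.Ioc ((n : ℝ) * h) (((n + 1 : ℕ) : ℝ) * h)) = h := by
      rw [Real.volume_Ioc, Nat.cast_succ, add_mul, add_sub_cancel_left, one_mul,
        ENNReal.ofReal_coe_nnreal]
    rw [← mul_assoc]
    refine le_trans (le_of_eq ?_) (setLIntegral_mono' (f := fun _ ↦
      P {ω | displacement m (increment Z 0 (n * h) ω) ≤ r} * 2⁻¹) measurableSet_Ioc fun s hs ↦ ?_)
    · rw [setLIntegral_const, hvol]
    have hs₀ : 0 ≤ s := (by positivity : (0 : ℝ) ≤ n * h).trans hs.1.le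
    lift s to ℝ≥0 using hs₀
    have hs₁ : n * h ≤ s := by exact_mod_cast hs.1.le
    have hs₂ : s ≤ n * h + h := by
      have := hs.2
      push_cast at this
      rw [add_mul, one_mul] at this
      exact_mod_cast this
    rw [Real.toNNReal_coe]
    -- A constant sequence of times: being in the r-ball at nh costs a factor 2 against the (r +
    -- 1)-ball at s.
    have hv := hZ.measure_exists_visit_le m r (s := fun _ ↦ n * h) monotone_const
      (fun _ ↦ hs₁) fun _ ↦ hhalf _ _ hs₁ hs₂
    simp only [exists_const] at hv
    exact ENNReal.div_le_of_le_mul' hv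
  rw [ENNReal.tsum_mul_right] at hle
  intro htop
  rw [htop, ENNReal.top_mul (by simp [hh.ne'])] at hle
  exact (hle.trans_lt hV).ne rfl

/-- A process with càdlàg paths for which balls have finite potential is transient. -/
theorem IsLevyProcess.isTransientAt [IsProbabilityMeasure P] (hZ : IsLevyProcess P Z)
    (hc : IsCadlag P Z) {m : M}
    (hV : ∀ r, inducedPotential P Z m (Metric.closedBall m r) < ∞) : IsTransientAt P Z m := by
  obtain ⟨h, hh, hhalf⟩ := hZ.exists_half_le_small_increment m
  have hBC : ∀ R : ℕ, ∀ᵐ ω ∂P, ∀ᶠ n : ℕ in atTop,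
      ω ∉ {ω | ∃ k j, displacement m (increment Z 0 (dyadicTime (n * h) h k j) ω) ≤ R} := by
    intro R
    refine ae_eventually_notMem (ne_top_of_le_ne_top ?_ (ENNReal.tsum_le_tsum fun n : ℕ ↦
      hZ.measure_exists_dyadic_visit_le m R hhalf (n * h)))
    rw [ENNReal.tsum_mul_left]
    refine ENNReal.mul_ne_top (by simp) (ne_top_of_le_ne_top
      (hZ.tsum_visits_ne_top m (R + 1) hh hhalf (hV _)) ?_)
    -- The interval starting at nh is controlled by its right end (n + 1)h, so the series is shifted
    -- by one.
    refine le_trans (le_of_eq ?_) (ENNReal.tsum_comp_le_tsum_of_injective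
      (Nat.succ_injective) _)
    simp [add_mul]
  filter_upwards [hc, hZ.increment_zero_ae, ae_all_iff.2 hBC] with ω hω hω₀ hev
  refine tendsto_atTop.2 fun b ↦ ?_
  obtain ⟨R, hR⟩ := exists_nat_ge b
  obtain ⟨N, hN⟩ := eventually_atTop.1 (hev R)
  filter_upwards [eventually_ge_atTop (N * h)] with t ht
  refine hR.trans ?_
  by_contra! hlt
  have hcont : ContinuousWithinAt (fun s ↦ displacement m (Z s ω)) (Set.Ici t) t :=
    (continuous_displacement m).continuousAt.comp_continuousWithinAt (hω t).1
  have hnear : ∀ᶠ s in 𝓝[≥] t, displacement m (Z s ω) < R :=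
    hcont.eventually (gt_mem_nhds hlt)
  -- A visit to the open ball at t persists on some [t, u), which contains a dyadic time.
  obtain ⟨u, hu, hsub⟩ := mem_nhdsGE_iff_exists_Ico_subset.1 hnear
  let n := ⌊t / h⌋₊
  have hn : n * h ≤ t := (le_div_iff₀ hh).1 (Nat.floor_le zero_le)
  have hn' : t < n * h + h := by
    have := (div_lt_iff₀ hh).1 (Nat.lt_floor_add_one (t / h))
    rwa [add_mul, one_mul] at this
  have hNn : N ≤ n := Nat.le_floor ((le_div_iff₀ hh).2 ht)
  obtain ⟨k, j, hkj, hkj'⟩ := exists_dyadicTime_mem_Ico hn hn' hu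
  refine hN n hNn ⟨k, j, ?_⟩
  rw [hω₀]
  exact (hsub ⟨hkj, hkj'⟩ : displacement m (Z _ ω) < R).le

end Recurrence

end GroupLevy

theorem mainTheorem4 {Ω G M : Type*}
    [MeasurableSpace Ω] (P : Measure Ω) [IsProbabilityMeasure P]
    -- a topological group with its Borel sigma-algebra, whose multiplication is measurable
    [Group G] [TopologicalSpace G] [IsTopologicalGroup G]
    [MeasurableSpace G] [BorelSpace G] [MeasurableMul₂ G]
    -- a complete metric space on which the group acts continuously by isometries
    [MetricSpace M] [CompleteSpace M] [MulAction G M] [ContinuousSMul G M] [IsIsometricSMul G M]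
    (Z : ℝ≥0 → Ω → G) (hZ : GroupLevy.IsLevyProcess P Z) (m : M) :
    (GroupLevy.IsTransientAt P Z m →
      ∀ K : Set M, IsCompact K → GroupLevy.inducedPotential P Z m K < ∞) ∧
    (MulAction.IsPretransitive G M → ProperSpace M → GroupLevy.IsCadlag P Z →
      (∀ K : Set M, IsCompact K → GroupLevy.inducedPotential P Z m K < ∞) →
      GroupLevy.IsTransientAt P Z m) :=
  ⟨fun h _ hK ↦ h.inducedPotential_lt_top hZ hK.isBounded, fun _ _ hc hV ↦
    hZ.isTransientAt hc fun r ↦ hV _ (isCompact_closedBall m r)⟩
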